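/- Let $K$ be an algebraically closed field and let $\Lambda$ be a finite-dimensional associative unital $K$-algebra. All modules are finitely generated left modules. A $\Lambda$-module $M$ is Gorenstein projective if there is an exact sequence $\cdots\to P_{-1}\to P_0\to P_1\to\cdots$ of finitely generated projective $\Lambda$-modules that stays exact under $\operatorname{Hom}_\Lambda(-,\Lambda)$ and satisfies $M\cong\operatorname{Im}(P_{-1}\to P_0)$. It is $\tau$-rigid if $\operatorname{Hom}_\Lambda(M,\tau M)=0$, where $\tau M=\operatorname{Hom}_K(\operatorname{Tr}M,K)$ is the Auslander--Reiten translate; here $\operatorname{Tr}M=\operatorname{Coker}\bigl(\operatorname{Hom}_\Lambda(P_0,\Lambda)\to\operatorname{Hom}_\Lambda(P_1,\Lambda)\bigr)$ for a minimal projective presentation $P_1\to P_0\to M\to 0$. The algebra $\Lambda$ is CM-$\tau$-tilting free if every Gorenstein projective $\tau$-rigid $\Lambda$-module is projective. It is Gorenstein if $\Lambda$ has finite injective dimension both as a left $\Lambda$-module and as a left $\Lambda^{\mathrm{op}}$-module. Let $T_2(\Lambda)=\begin{pmatrix}\Lambda&0\\ \Lambda&\Lambda\end{pmatrix}$ be the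 algebra of lower triangular $2\times 2$ matrices over $\Lambda$. Then: (1) $\Lambda$ is CM-$\tau$-tilting free if and only if its opposite algebra $\Lambda^{\mathrm{op}}$ is CM-$\tau$-tilting free. (2) If $\Lambda$ is Gorenstein, then $\Lambda$ is CM-$\tau$-tilting free if and only if $T_2(\Lambda)$ is CM-$\tau$-tilting free. -/

import Mathlib

open CategoryTheory

universe u v w

noncomputable section

/-- For a left `Λ`-module `P`, the abelian group `P →ₗ[Λ] Λ` carries Mathlib's right `Λ`-module
structure (a left module over `Λᵐᵒᵖ`) `(op a • φ) x = φ x * a`. The map `f* : φ ↦ φ ∘ f`. -/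
def starMap {Λ : Type u} [Ring Λ] {P Q : Type w} [AddCommGroup P] [Module Λ P]
    [AddCommGroup Q] [Module Λ Q] (f : P →ₗ[Λ] Q) : (Q →ₗ[Λ] Λ) →ₗ[Λᵐᵒᵖ] (P →ₗ[Λ] Λ) where
  toFun φ := φ.comp f
  map_add' _ _ := rfl
  map_smul' _ _ := rfl

/-- `M` is Gorenstein projective: `M ≃ Im (P₋₁ → P₀)` for an exact sequence
`⋯ → P₋₁ → P₀ → P₁ → ⋯` of finitely generated projective modules that stays exact under
`Hom_Λ(-, Λ)`. -/
def IsGorensteinProjective (Λ : Type u) [Ring Λ] (M : Type u) [AddCommGroup M] [Module Λ M] :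
    Prop :=
  ∃ (P : ℤ → Type u) (_ : ∀ i, AddCommGroup (P i)) (_ : ∀ i, Module Λ (P i))
    (d : ∀ i, P i →ₗ[Λ] P (i + 1)),
    (∀ i, Module.Finite Λ (P i)) ∧ (∀ i, Module.Projective Λ (P i)) ∧
    (∀ i, Function.Exact (d i) (d (i + 1))) ∧
    (∀ i, Function.Exact (starMap (d (i + 1))) (starMap (d i))) ∧
    Nonempty (M ≃ₗ[Λ] LinearMap.range (d (-1)))

/-- A submodule `N` of `M` is superfluous if `L + N = M` forces `L = M`. -/
def IsSuperfluous {Λ : Type u} [Ring Λ] {M : Type w} [AddCommGroup M] [Module Λ M]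
    (N : Submodule Λ M) : Prop :=
  ∀ L : Submodule Λ M, L ⊔ N = ⊤ → L = ⊤

/-- `P₁ -f→ P₀ -g→ M → 0` is a minimal projective presentation of `M`: it is exact, `P₀` and `P₁`
are finitely generated projective, and both `P₀ → M` and `P₁ → Im f` are projective covers. -/
structure IsMinimalProjectivePresentation {Λ : Type u} [Ring Λ] {P₁ P₀ M : Type w}
    [AddCommGroup P₁] [Module Λ P₁] [AddCommGroup P₀] [Module Λ P₀] [AddCommGroup M] [Module Λ M]
    (f : P₁ →ₗ[Λ] P₀) (g : P₀ →ₗ[Λ] M) : Prop where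
  finite₁ : Module.Finite Λ P₁
  finite₀ : Module.Finite Λ P₀
  projective₁ : Module.Projective Λ P₁
  projective₀ : Module.Projective Λ P₀
  exact : Function.Exact f g
  surjective : Function.Surjective g
  minimal₀ : IsSuperfluous (LinearMap.ker g)
  minimal₁ : IsSuperfluous (LinearMap.ker f)

/-- The transpose `Coker (f* : P₀* → P₁*)`, a right `Λ`-module. It is `Tr M` when `f` is the first
map of a minimal projective presentation `P₁ → P₀ → M → 0`. -/
abbrev Transpose {Λ : Type u} [Ring Λ] {P₁ P₀ : Type w} [AddCommGroup P₁] [Module Λ P₁]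
    [AddCommGroup P₀] [Module Λ P₀] (f : P₁ →ₗ[Λ] P₀) : Type (max u w) :=
  (P₁ →ₗ[Λ] Λ) ⧸ LinearMap.range (starMap f)

/-- The `K`-dual `𝔻 N = Hom_K(N, K)` of a right `Λ`-module `N`, as a left `Λ`-module. -/
def KDual (K : Type v) (Λ : Type u) (N : Type w) [Field K] [Ring Λ] [Algebra K Λ]
    [AddCommGroup N] [Module K N] [Module Λᵐᵒᵖ N] [IsScalarTower K Λᵐᵒᵖ N] : Type (max v w) :=
  N →ₗ[K] K

section KDual

variable (K : Type v) (Λ : Type u) (N : Type w) [Field K] [Ring Λ] [Algebra K Λ]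
  [AddCommGroup N] [Module K N] [Module Λᵐᵒᵖ N] [IsScalarTower K Λᵐᵒᵖ N]

instance : AddCommGroup (KDual K Λ N) := inferInstanceAs (AddCommGroup (N →ₗ[K] K))

/-- `(a • ξ) n = ξ (n a)`. -/
instance : Module Λ (KDual K Λ N) where
  smul a ξ := LinearMap.comp (show N →ₗ[K] K from ξ) (Algebra.lsmul K K N (MulOpposite.op a))
  one_smul ξ := LinearMap.ext fun n => congrArg (show N →ₗ[K] K from ξ) (one_smul Λᵐᵒᵖ n)
  mul_smul a b ξ := LinearMap.ext fun n => congrArg (show N →ₗ[K] K from ξ)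
    (mul_smul (MulOpposite.op b) (MulOpposite.op a) n)
  smul_zero _ := rfl
  smul_add _ _ _ := rfl
  add_smul a b ξ := LinearMap.ext fun n =>
    (congrArg (show N →ₗ[K] K from ξ) (add_smul (MulOpposite.op a) (MulOpposite.op b) n)).trans
      (map_add (show N →ₗ[K] K from ξ) _ _)
  zero_smul ξ := LinearMap.ext fun n =>
    (congrArg (show N →ₗ[K] K from ξ) (zero_smul Λᵐᵒᵖ n)).trans (map_zero (show N →ₗ[K] K from ξ))

end KDual

/-- The Auslander–Reiten translate `τ M = 𝔻 Tr M`, computed from the first map `f` of a minimal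
projective presentation of `M`. -/
abbrev ARTranslate (K : Type v) {Λ : Type u} [Field K] [Ring Λ] [Algebra K Λ] {P₁ P₀ : Type w}
    [AddCommGroup P₁] [Module Λ P₁] [AddCommGroup P₀] [Module Λ P₀] (f : P₁ →ₗ[Λ] P₀) :
    Type (max u v w) :=
  KDual K Λ (Transpose f)

/-- `M` is `τ`-rigid: `Hom_Λ(M, τ M) = 0`. A finitely generated module over a finite-dimensional
algebra has a minimal projective presentation, unique up to isomorphism, so the choice of the
presentation that computes `τ M` does not matter. -/
def IsTauRigid (K : Type v) (Λ : Type u) [Field K] [Ring Λ] [Algebra K Λ]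
    (M : Type u) [AddCommGroup M] [Module Λ M] : Prop :=
  ∃ (P₁ P₀ : Type u) (_ : AddCommGroup P₁) (_ : Module Λ P₁) (_ : AddCommGroup P₀)
    (_ : Module Λ P₀) (f : P₁ →ₗ[Λ] P₀) (g : P₀ →ₗ[Λ] M),
    IsMinimalProjectivePresentation f g ∧ ∀ h : M →ₗ[Λ] ARTranslate K f, h = 0

/-- `Λ` is CM-`τ`-tilting free: every finitely generated Gorenstein projective `τ`-rigid left
`Λ`-module is projective. -/
def IsCMTauTiltingFree (K : Type v) (Λ : Type u) [Field K] [Ring Λ] [Algebra K Λ] : Prop :=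
  ∀ (M : Type u) [AddCommGroup M] [Module Λ M], Module.Finite Λ M →
    IsGorensteinProjective Λ M → IsTauRigid K Λ M → Module.Projective Λ M

/-- `Λ` is Gorenstein: the left `Λ`-module `Λ` and the left `Λᵐᵒᵖ`-module `Λᵐᵒᵖ` have finite
injective dimension. -/
def IsGorensteinAlgebra (Λ : Type u) [Ring Λ] : Prop :=
  (∃ n : ℕ, HasInjectiveDimensionLE (ModuleCat.of Λ Λ) n) ∧
    ∃ n : ℕ, HasInjectiveDimensionLE (ModuleCat.of Λᵐᵒᵖ Λᵐᵒᵖ) n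

/-- The lower triangular matrix algebra `T₂(Λ)`. -/
def T₂ (K : Type v) (Λ : Type u) [Field K] [Ring Λ] [Algebra K Λ] :
    Subalgebra K (Matrix (Fin 2) (Fin 2) Λ) where
  carrier := {A | A 0 1 = 0}
  mul_mem' {A B} hA hB := by
    simp only [Set.mem_ofPred_eq] at hA hB ⊢
    simp [Matrix.mul_apply, Fin.sum_univ_two, hA, hB]
  add_mem' {A B} hA hB := by
    simp only [Set.mem_ofPred_eq] at hA hB ⊢
    simp [hA, hB]
  algebraMap_mem' r := by simp [Matrix.algebraMap_matrix_apply]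

end

/-! Everything is read off from one differential `f : P → Q` of a complete resolution, presenting
the Gorenstein projective module `M = Coker f`. Expanding along a dual basis of `P₁`, `Hom(M, 𝔻 Tr
M)` vanishes exactly when every map `P₁ → M` factors through the minimal presentation map `P₁ → P₀`.
Lifting along projectives turns this into rigidity of `f`: every `P → Q` has the form `f β + γ f`.
Likewise `M` is projective iff `f s f = f` for some `s`. As minimal presentations can be found
inside complete resolutions, CM-τ-tilting freeness becomes: every rigid differential of every
complete resolution is regular (`isCMTauTiltingFree_iff`).

This criterion is compatible with `Hom(-, Λ)`, which exchanges complete resolutions over `Λ` and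
`Λᵐᵒᵖ`; hence (1).

For (2), a complete resolution over `Λ` becomes one over `T₂(Λ)` through the lower right entry, with
the same maps between its terms, so regularity descends to `Λ`. Conversely, a complete resolution
over `T₂(Λ)` has an upper part and a lower quotient, both complete resolutions over `Λ`, whose
differentials inherit rigidity. Their quasi-inverses lift to a common `s`, and the defect `f - f s
f` takes values in the corner part and kills the corner part. Exactness then makes it vanish on the
image of `1 - s f`, and `2s - s f s` is a quasi-inverse of `f` (`isRegularMap_of_entries`). -/

noncomputable section

/-! ### Dual bases and lifting -/

section DualBasis

variable {Λ : Type*} [Ring Λ] {P Q M N : Type*} [AddCommGroup P] [Module Λ P]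
  [AddCommGroup Q] [Module Λ Q] [AddCommGroup M] [Module Λ M] [AddCommGroup N] [Module Λ N]

variable (Λ P) in
/-- `P` has a finite dual basis: `x = ∑ φⱼ(x) qⱼ` for finitely many `qⱼ ∈ P` and `φⱼ ∈ P*`. -/
def HasFiniteDualBasis : Prop :=
  ∃ (n : ℕ) (q : Fin n → P) (φ : Fin n → P →ₗ[Λ] Λ), ∀ x, ∑ j, φ j x • q j = x

theorem HasFiniteDualBasis.of_finite_projective (hf : Module.Finite Λ P)
    (hp : Module.Projective Λ P) : HasFiniteDualBasis Λ P := by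
  obtain ⟨n, f, g, -, -, hfg⟩ := Module.Finite.exists_comp_eq_id_of_projective Λ P
  refine ⟨n, fun j => f fun i => if j = i then 1 else 0, fun j => (LinearMap.proj j).comp g,
    fun x => ?_⟩
  have h := LinearMap.congr_fun hfg x
  rw [LinearMap.comp_apply, LinearMap.id_apply, LinearMap.pi_apply_eq_sum_univ f] at h
  simpa using h

theorem HasFiniteDualBasis.finite (h : HasFiniteDualBasis Λ P) : Module.Finite Λ P := by
  obtain ⟨n, q, φ, h⟩ := h
  refine Module.Finite.of_surjective (Fintype.linearCombination Λ q) fun x =>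
    ⟨fun j => φ j x, ?_⟩
  rw [Fintype.linearCombination_apply, h]

theorem HasFiniteDualBasis.projective (h : HasFiniteDualBasis Λ P) : Module.Projective Λ P := by
  obtain ⟨n, q, φ, h⟩ := h
  refine Module.Projective.of_split (LinearMap.pi φ) (Fintype.linearCombination Λ q) ?_
  ext x
  simp [Fintype.linearCombination_apply, h]

/-- Lifting of a map from a projective module along a map whose range contains its values. -/
theorem Module.Projective.exists_lift (hP : Module.Projective Λ P) (a : P →ₗ[Λ] N)
    (b : M →ₗ[Λ] N) (h : ∀ x, ∃ y, b y = a x) : ∃ c : P →ₗ[Λ] M, ∀ x, b (c x) = a x := by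
  obtain ⟨c, hc⟩ := Module.projective_lifting_property b.rangeRestrict
    (a.codRestrict (LinearMap.range b) h) b.surjective_rangeRestrict
  exact ⟨c, fun x => congrArg Subtype.val (LinearMap.congr_fun hc x)⟩

end DualBasis

/-! ### Rigidity and regularity of presentations -/

section RigidMaps

variable {Λ : Type*} [Ring Λ] {P Q M P' Q' : Type*} [AddCommGroup P] [Module Λ P]
  [AddCommGroup Q] [Module Λ Q] [AddCommGroup M] [Module Λ M]
  [AddCommGroup P'] [Module Λ P'] [AddCommGroup Q'] [Module Λ Q']

/-- `f : P → Q` is rigid: every map `P → Q` is of the form `f β + γ f`, that is, the two-term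
complex `f` has no nonzero maps to its shift in the homotopy category. -/
def IsRigidMap (f : P →ₗ[Λ] Q) : Prop :=
  ∀ α : P →ₗ[Λ] Q, ∃ (β : P →ₗ[Λ] P) (γ : Q →ₗ[Λ] Q), ∀ x, α x = f (β x) + γ (f x)

/-- `f` is von Neumann regular: `f s f = f` for some `s`. -/
def IsRegularMap (f : P →ₗ[Λ] Q) : Prop :=
  ∃ s : Q →ₗ[Λ] P, ∀ x, f (s (f x)) = f x

/-- Every map `P → M` factors through `f : P → Q`. -/
def MapsFactorThrough (M : Type*) [AddCommGroup M] [Module Λ M] (f : P →ₗ[Λ] Q) : Prop :=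
  ∀ φ : P →ₗ[Λ] M, ∃ ψ : Q →ₗ[Λ] M, ∀ x, φ x = ψ (f x)

/-- Modulo maps `f β`, a map `P → Q` is the same as its composite `P → M` with `g`, because `P` is
projective and `ker g = Im f`. Projectivity of `Q` lifts a factorization `ψ : Q → M` to `γ`. -/
theorem isRigidMap_iff_mapsFactorThrough (hP : Module.Projective Λ P)
    (hQ : Module.Projective Λ Q) {f : P →ₗ[Λ] Q} {g : Q →ₗ[Λ] M} (hfg : Function.Exact f g)
    (hg : Function.Surjective g) : IsRigidMap f ↔ MapsFactorThrough M f := by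
  constructor
  · intro h φ
    obtain ⟨α, hα⟩ := hP.exists_lift φ g fun x => hg _
    obtain ⟨β, γ, hβγ⟩ := h α
    refine ⟨g.comp γ, fun x => ?_⟩
    rw [← hα, hβγ, map_add, hfg.apply_apply_eq_zero, zero_add, LinearMap.comp_apply]
  · intro h α
    obtain ⟨ψ, hψ⟩ := h (g.comp α)
    obtain ⟨γ, hγ⟩ := hQ.exists_lift ψ g fun x => hg _
    obtain ⟨β, hβ⟩ := hP.exists_lift (α - γ.comp f) f fun x => (hfg _).1 <| by
      have := hψ x
      simp only [LinearMap.comp_apply] at this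
      simp [hγ, this]
    exact ⟨β, γ, fun x => by simp [hβ]⟩

/-- The map `1 - f s` kills `Im f = ker g`, so it descends to a section of `g`. -/
theorem IsRegularMap.projective (hQ : Module.Projective Λ Q) {f : P →ₗ[Λ] Q} {g : Q →ₗ[Λ] M}
    (hfg : Function.Exact f g) (hg : Function.Surjective g) (h : IsRegularMap f) :
    Module.Projective Λ M := by
  obtain ⟨s, hs⟩ := h
  have hker : LinearMap.ker g ≤ LinearMap.ker (LinearMap.id - f.comp s) := fun y hy => by
    obtain ⟨x, rfl⟩ := (hfg y).1 hy
    simp [hs]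
  let i : M →ₗ[Λ] Q := ((LinearMap.ker g).liftQ _ hker).comp
    (g.quotKerEquivOfSurjective hg).symm.toLinearMap
  have hi : ∀ y, i (g y) = y - f (s y) := fun y => by
    have : (g.quotKerEquivOfSurjective hg).symm (g y) = Submodule.Quotient.mk y := by
      rw [LinearEquiv.symm_apply_eq]; rfl
    simp [i, this]
  refine Module.Projective.of_split i g (LinearMap.ext fun m => ?_)
  obtain ⟨y, rfl⟩ := hg m
  simp [hi, hfg.apply_apply_eq_zero]

theorem IsRegularMap.of_projective (hQ : Module.Projective Λ Q) {f : P →ₗ[Λ] Q} {g : Q →ₗ[Λ] M}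
    (hfg : Function.Exact f g) (hg : Function.Surjective g) (hM : Module.Projective Λ M) :
    IsRegularMap f := by
  obtain ⟨i, hi⟩ := hM.exists_lift LinearMap.id g fun x => hg _
  obtain ⟨s, hs⟩ := hQ.exists_lift (LinearMap.id - i.comp g) f fun x => (hfg _).1 <| by simp [hi]
  exact ⟨s, fun x => by simp [hs, hfg.apply_apply_eq_zero]⟩

/-- If the maps to `M` factor through some projective presentation of `M`, they factor through
every minimal one. -/
theorem MapsFactorThrough.of_superfluous (hP : Module.Projective Λ P)
    (hQ : Module.Projective Λ Q) (hP' : Module.Projective Λ P') (hQ' : Module.Projective Λ Q')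
    {f : P →ₗ[Λ] Q} {g : Q →ₗ[Λ] M} (hfg : Function.Exact f g) (hg : Function.Surjective g)
    {f' : P' →ₗ[Λ] Q'} {g' : Q' →ₗ[Λ] M} (hfg' : Function.Exact f' g')
    (hg' : Function.Surjective g') (hf' : IsSuperfluous (LinearMap.ker f'))
    (h : MapsFactorThrough M f) : MapsFactorThrough M f' := by
  obtain ⟨v₀, hv₀⟩ := hQ.exists_lift g g' fun x => hg' _
  obtain ⟨u₀, hu₀⟩ := hQ'.exists_lift g' g fun x => hg _
  obtain ⟨v₁, hv₁⟩ := hP.exists_lift (v₀.comp f) f' fun x => (hfg' _).1 <| by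
    simp [hv₀, hfg.apply_apply_eq_zero]
  obtain ⟨u₁, hu₁⟩ := hP'.exists_lift (u₀.comp f') f fun x => (hfg _).1 <| by
    simp [hu₀, hfg'.apply_apply_eq_zero]
  obtain ⟨s, hs⟩ := hQ'.exists_lift (v₀.comp u₀ - LinearMap.id) f' fun x => (hfg' _).1 <| by
    simp [hv₀, hu₀]
  simp only [LinearMap.comp_apply, LinearMap.sub_apply, LinearMap.id_apply] at hv₁ hu₁ hs
  -- The comparison `P' → P → P'` corrected by the homotopy `s`, so that `f' r = f'`. Then `P' = Im
  -- r + ker f'`, and minimality makes `r` surjective, hence split by some `t`.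
  let r : P' →ₗ[Λ] P' := v₁.comp u₁ - s.comp f'
  have hr : ∀ x, f' (r x) = f' x := fun x => by simp [r, hv₁, hu₁, hs]
  have hrange : LinearMap.range r = ⊤ := hf' _ <| eq_top_iff.2 fun x _ =>
    Submodule.mem_sup.2 ⟨r x, ⟨x, rfl⟩, x - r x, by simp [hr], by abel⟩
  obtain ⟨t, ht⟩ := hP'.exists_lift LinearMap.id r fun x => LinearMap.range_eq_top.1 hrange x
  have hft : ∀ x, f' (t x) = f' x := fun x => by rw [← hr, ht]; rfl
  intro φ
  obtain ⟨ψ, hψ⟩ := h (φ.comp v₁)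
  refine ⟨ψ.comp u₀ - φ.comp s, fun x => ?_⟩
  have key : φ (r (t x)) = ψ (u₀ (f' (t x))) - φ (s (f' (t x))) := by
    simp only [r, LinearMap.sub_apply, LinearMap.comp_apply, map_sub]
    rw [← hu₁, ← hψ]; rfl
  rw [ht, hft] at key
  simpa using key

end RigidMaps

/-! ### τ-rigidity as a factorization property -/

section TauRigid

variable {Λ : Type u} [Ring Λ]

/-- `Hom(M, τ M) = 0` if and only if every map `P₁ → M` factors through `f : P₁ → P₀`. -/
theorem hom_arTranslate_eq_zero_iff (K : Type v) [Field K] [Algebra K Λ] {P₁ P₀ M : Type w}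
    [AddCommGroup P₁] [Module Λ P₁] [AddCommGroup P₀] [Module Λ P₀] [AddCommGroup M] [Module Λ M]
    (h₁ : HasFiniteDualBasis Λ P₁) (h₀ : HasFiniteDualBasis Λ P₀) (f : P₁ →ₗ[Λ] P₀) :
    (∀ h : M →ₗ[Λ] ARTranslate K f, h = 0) ↔ MapsFactorThrough M f := by
  obtain ⟨n, q, φ, hφ⟩ := h₁
  obtain ⟨m, r, θ, hθ⟩ := h₀
  have expand : ∀ χ : P₁ →ₗ[Λ] M, χ = ∑ j, (φ j).smulRight (χ (q j)) := fun χ => by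
    ext x
    conv_lhs => rw [← hφ x]
    simp
  constructor
  · intro H χ
    let : Module K M := Module.compHom M (algebraMap K Λ)
    have : IsScalarTower K Λ M := ⟨fun k a x => by
      rw [Algebra.smul_def, mul_smul]; rfl⟩
    by_contra hχ
    have hmem : χ ∉ LinearMap.range (LinearMap.lcomp K M f) := by
      rintro ⟨ψ, rfl⟩
      exact hχ ⟨ψ, fun x => rfl⟩
    -- A functional that kills all maps factoring through `f` but not `χ`. It induces `y ↦ (ξ ↦ Φ
    -- (ξ(-) y))` from `M` to `τ M`; this is zero by assumption, so the dual basis expansion of `χ`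
    -- forces `Φ χ = 0`.
    obtain ⟨Φ, hΦ, hle⟩ := Submodule.exists_le_ker_of_notMem hmem
    have hΦf : ∀ (ξ : P₀ →ₗ[Λ] Λ) (y : M), Φ ((ξ.comp f).smulRight y) = 0 := fun ξ y =>
      hle ⟨ξ.smulRight y, rfl⟩
    let b (y : M) : (P₁ →ₗ[Λ] Λ) →ₗ[K] K :=
      { toFun := fun ξ => Φ (ξ.smulRight y)
        map_add' := fun ξ η => by
          rw [← map_add]; congr 1; ext x; simp [add_smul]
        map_smul' := fun k ξ => by
          rw [RingHom.id_apply, ← map_smul]; congr 1; ext x; simp [smul_assoc] }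
    have hb : ∀ y, (LinearMap.range (starMap f)).restrictScalars K ≤ LinearMap.ker (b y) := by
      rintro y _ ⟨ξ, rfl⟩
      exact hΦf ξ y
    let c (y : M) : Transpose f →ₗ[K] K :=
      ((LinearMap.range (starMap f)).restrictScalars K).liftQ (b y) (hb y) ∘ₗ
        (Submodule.Quotient.restrictScalarsEquiv K (LinearMap.range (starMap f))).symm.toLinearMap
    have hc : ∀ y ξ, c y (Submodule.Quotient.mk ξ) = Φ (ξ.smulRight y) := fun y ξ => rfl
    let h : M →ₗ[Λ] ARTranslate K f :=
      { toFun := c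
        map_add' := fun y z => LinearMap.ext fun ξ => by
          obtain ⟨ξ, rfl⟩ := Submodule.Quotient.mk_surjective _ ξ
          change c (y + z) (Submodule.Quotient.mk ξ) =
            c y (Submodule.Quotient.mk ξ) + c z (Submodule.Quotient.mk ξ)
          rw [hc, hc, hc, ← map_add]; congr 1; ext x; simp
        map_smul' := fun a y => LinearMap.ext fun ξ => by
          obtain ⟨ξ, rfl⟩ := Submodule.Quotient.mk_surjective _ ξ
          change c (a • y) (Submodule.Quotient.mk ξ) =
            c y (Submodule.Quotient.mk (MulOpposite.op a • ξ))
          rw [hc, hc]; congr 1; ext x; simp [mul_smul] }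
    apply hΦ
    rw [expand χ, map_sum]
    refine Finset.sum_eq_zero fun j _ => ?_
    rw [← hc]
    exact LinearMap.congr_fun (LinearMap.congr_fun (H h) (χ (q j)))
      (Submodule.Quotient.mk (φ j) : Transpose f)
  · intro H h
    let b (y : M) (ξ : P₁ →ₗ[Λ] Λ) : K :=
      (show Transpose f →ₗ[K] K from h y) (Submodule.Quotient.mk ξ)
    have hsmul : ∀ (a : Λ) y ξ, b (a • y) ξ = b y (MulOpposite.op a • ξ) := fun a y ξ => by
      simp only [b, map_smul]; rfl
    have hadd : ∀ y z ξ, b (y + z) ξ = b y ξ + b z ξ := fun y z ξ => by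
      simp only [b, map_add]; rfl
    have hsum : ∀ y (s : Fin n → P₁ →ₗ[Λ] Λ), b y (∑ j, s j) = ∑ j, b y (s j) := fun y s =>
      map_sum ((show Transpose f →ₗ[K] K from h y).toAddMonoidHom.comp
        (LinearMap.range (starMap f)).mkQ.toAddMonoidHom) s Finset.univ
    have hf : ∀ y (ξ : P₀ →ₗ[Λ] Λ), b y (ξ.comp f) = 0 := fun y ξ => by
      have : (Submodule.Quotient.mk (ξ.comp f) : Transpose f) = 0 :=
        (Submodule.Quotient.mk_eq_zero _).2 ⟨ξ, rfl⟩
      simp only [b, this]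
      exact map_zero (show Transpose f →ₗ[K] K from h y)
    -- The inverse construction: the functional with `Φ (ξ(-) y) = h(y)(ξ)`. It vanishes on maps
    -- factoring through `f`.
    let Φ : (P₁ →ₗ[Λ] M) →+ K :=
      AddMonoidHom.mk' (fun χ => ∑ j, b (χ (q j)) (φ j)) fun χ χ' => by
        simp [hadd, Finset.sum_add_distrib]
    have hΦ : ∀ y (ξ : P₁ →ₗ[Λ] Λ), Φ (ξ.smulRight y) = b y ξ := fun y ξ => by
      change ∑ j, b (ξ (q j) • y) (φ j) = _
      simp only [hsmul, ← hsum]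
      congr 1
      ext x
      conv_rhs => rw [← hφ x]
      simp
    refine LinearMap.ext fun y => LinearMap.ext fun ξ => ?_
    obtain ⟨ξ, rfl⟩ := Submodule.Quotient.mk_surjective _ ξ
    change b y ξ = 0
    obtain ⟨ψ, hψ⟩ := H (ξ.smulRight y)
    have : ξ.smulRight y = ∑ k, ((θ k).comp f).smulRight (ψ (r k)) := by
      ext x
      rw [hψ]
      conv_lhs => rw [← hθ (f x)]
      simp
    rw [← hΦ, this, map_sum]
    exact Finset.sum_eq_zero fun k _ => by rw [hΦ, hf]

end TauRigid

/-! ### Complete resolutions and their direct summands -/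

/-- A totally acyclic complex of finitely generated projective modules, with differentials
`d i j : X i → X j` for `i + 1 = j`. -/
structure CompleteResolution (Λ : Type u) [Ring Λ] where
  X : ℤ → Type u
  [addCommGroup : ∀ i, AddCommGroup (X i)]
  [module : ∀ i, Module Λ (X i)]
  d : ∀ i j, i + 1 = j → (X i →ₗ[Λ] X j)
  dualBasis : ∀ i, HasFiniteDualBasis Λ (X i)
  exact : ∀ i j k (hij : i + 1 = j) (hjk : j + 1 = k), Function.Exact (d i j hij) (d j k hjk)
  dual_exact : ∀ i j k (hij : i + 1 = j) (hjk : j + 1 = k) (φ : X j →ₗ[Λ] Λ),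
    φ.comp (d i j hij) = 0 → ∃ ψ : X k →ₗ[Λ] Λ, ψ.comp (d j k hjk) = φ

namespace CompleteResolution

attribute [instance] addCommGroup module

variable {Λ : Type u} [Ring Λ] (C : CompleteResolution Λ)

theorem d_d {i j k : ℤ} (hij : i + 1 = j) (hjk : j + 1 = k) (x : C.X i) :
    C.d j k hjk (C.d i j hij x) = 0 :=
  (C.exact i j k hij hjk).apply_apply_eq_zero x

theorem dual_exact' {i j k : ℤ} (hij : i + 1 = j) (hjk : j + 1 = k) :
    Function.Exact (starMap (C.d j k hjk)) (starMap (C.d i j hij)) := fun φ =>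
  ⟨C.dual_exact i j k hij hjk φ, by
    rintro ⟨ψ, rfl⟩
    exact LinearMap.ext fun x => (congrArg ψ (C.d_d hij hjk x)).trans (map_zero ψ)⟩

theorem projective (i : ℤ) : Module.Projective Λ (C.X i) := (C.dualBasis i).projective

theorem finite (i : ℤ) : Module.Finite Λ (C.X i) := (C.dualBasis i).finite

/-- `M` is the cokernel of the differential `C.X i → C.X j` via `g`. -/
structure IsCokernel {M : Type*} [AddCommGroup M] [Module Λ M] {i j : ℤ} (h : i + 1 = j)
    (g : C.X j →ₗ[Λ] M) : Prop where
  exact : Function.Exact (C.d i j h) g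
  surjective : Function.Surjective g

theorem isCokernel_mkQ {i j : ℤ} (h : i + 1 = j) :
    C.IsCokernel h (LinearMap.range (C.d i j h)).mkQ :=
  ⟨LinearMap.exact_iff.2 (by simp), Submodule.mkQ_surjective _⟩

/-- By exactness the cokernel of one differential is the image of the next; a translation by `c`
moves that one to degree `-1`. -/
theorem IsCokernel.isGorensteinProjective {C : CompleteResolution Λ} {M : Type u}
    [AddCommGroup M] [Module Λ M] {i j : ℤ} {h : i + 1 = j} {g : C.X j →ₗ[Λ] M}
    (hg : C.IsCokernel h g) : IsGorensteinProjective Λ M := by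
  obtain ⟨c, rfl⟩ : ∃ c, j = -1 + c := ⟨j + 1, by ring⟩
  refine ⟨fun i => C.X (i + c), inferInstance, inferInstance,
    fun i => C.d (i + c) (i + 1 + c) (by ring), fun i => C.finite _, fun i => C.projective _,
    fun i => C.exact _ _ _ _ _, fun i => C.dual_exact' _ _, ⟨?_⟩⟩
  refine (g.quotKerEquivOfSurjective hg.surjective).symm.trans
    ((Submodule.quotEquivOfEq _ _ ?_).trans (LinearMap.quotKerEquivRange _))
  ext x
  rw [LinearMap.mem_ker, LinearMap.mem_ker]
  exact (hg.exact x).trans (C.exact i (-1 + c) (-1 + 1 + c) h (by ring) x).symm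

theorem exists_isCokernel {M : Type u} [AddCommGroup M] [Module Λ M]
    (hM : IsGorensteinProjective Λ M) :
    ∃ (C : CompleteResolution Λ) (i j : ℤ) (h : i + 1 = j) (g : C.X j →ₗ[Λ] M),
      C.IsCokernel h g := by
  obtain ⟨P, _, _, d, hfin, hproj, hex, hdual, ⟨e⟩⟩ := hM
  let D : ∀ i j, i + 1 = j → (P i →ₗ[Λ] P j) := fun i j h => h ▸ d i
  have hD : ∀ i j k (hij : i + 1 = j) (hjk : j + 1 = k),
      Function.Exact (D i j hij) (D j k hjk) := by
    rintro i _ _ rfl rfl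
    exact hex i
  let C : CompleteResolution Λ :=
    { X := P
      d := D
      dualBasis := fun i => .of_finite_projective (hfin i) (hproj i)
      exact := hD
      dual_exact := by
        rintro i _ _ rfl rfl φ hφ
        exact (hdual i φ).1 hφ }
  refine ⟨C, -2, -1, rfl, e.symm.toLinearMap.comp (d (-1)).rangeRestrict, ⟨fun x => ?_, ?_⟩⟩
  · have := hD (-2) (-1) 0 rfl rfl x
    refine Iff.trans ?_ this
    rw [LinearMap.comp_apply, LinearEquiv.coe_coe, LinearEquiv.map_eq_zero_iff, Subtype.ext_iff]
    rfl
  · exact e.symm.surjective.comp (d (-1)).surjective_rangeRestrict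

/-- The image of an idempotent chain endomorphism. -/
def ofIdempotent (e : ∀ i, C.X i →ₗ[Λ] C.X i) (he : ∀ i x, e i (e i x) = e i x)
    (hd : ∀ i j h x, C.d i j h (e i x) = e j (C.d i j h x)) : CompleteResolution Λ where
  X i := LinearMap.range (e i)
  d i j h := (C.d i j h).restrict (p := LinearMap.range (e i)) (q := LinearMap.range (e j)) (by
    rintro _ ⟨x, rfl⟩
    exact ⟨_, (hd i j h x).symm⟩)
  dualBasis i := by
    obtain ⟨n, q, φ, hφ⟩ := C.dualBasis i
    refine ⟨n, fun j => (e i).rangeRestrict (q j), fun j => (φ j).comp (Submodule.subtype _), ?_⟩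
    rintro ⟨_, x, rfl⟩
    ext
    have := congrArg (e i) (hφ (e i x))
    rw [he] at this
    simpa using this
  exact i j k hij hjk := by
    rintro ⟨_, x, rfl⟩
    constructor
    · intro h
      obtain ⟨y, hy⟩ := (C.exact i j k hij hjk _).1 (congrArg Subtype.val h)
      refine ⟨⟨e i y, y, rfl⟩, Subtype.ext ?_⟩
      change C.d i j hij (e i y) = e j x
      exact (hd _ _ _ y).trans ((congrArg (e j) hy).trans (he j x))
    · rintro ⟨y, hy⟩
      rw [← hy]
      exact Subtype.ext (C.d_d hij hjk y.1)
  dual_exact i j k hij hjk φ hφ := by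
    obtain ⟨ψ, hψ⟩ := C.dual_exact i j k hij hjk (φ.comp (e j).rangeRestrict) <| by
      ext x
      refine Eq.trans ?_ (LinearMap.congr_fun hφ ⟨e i x, x, rfl⟩)
      exact congrArg φ (Subtype.ext (hd i j hij x).symm)
    refine ⟨ψ.comp (Submodule.subtype _), LinearMap.ext ?_⟩
    rintro ⟨_, x, rfl⟩
    refine (LinearMap.congr_fun hψ (e j x)).trans ?_
    exact congrArg φ (Subtype.ext (he j x))

variable {C}

theorem IsCokernel.ofIdempotent {M : Type*} [AddCommGroup M] [Module Λ M] {i j : ℤ}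
    {h : i + 1 = j} {g : C.X j →ₗ[Λ] M} (hg : C.IsCokernel h g)
    {e : ∀ i, C.X i →ₗ[Λ] C.X i} (he : ∀ i x, e i (e i x) = e i x)
    (hd : ∀ i j h x, C.d i j h (e i x) = e j (C.d i j h x)) (hge : ∀ x, g (e j x) = g x) :
    (C.ofIdempotent e he hd).IsCokernel h (g.comp (Submodule.subtype _)) where
  exact := by
    rintro ⟨_, x, rfl⟩
    constructor
    · intro h0
      obtain ⟨y, hy⟩ := (hg.exact _).1 h0
      refine ⟨⟨e i y, y, rfl⟩, Subtype.ext ?_⟩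
      change C.d i j h (e i y) = e j x
      exact (hd _ _ _ y).trans ((congrArg (e j) hy).trans (he j x))
    · rintro ⟨y, hy⟩
      rw [← hy]
      exact hg.exact.apply_apply_eq_zero y.1
  surjective m := by
    obtain ⟨x, rfl⟩ := hg.surjective m
    exact ⟨⟨e j x, x, rfl⟩, hge x⟩

/-- A direct summand of `C.X j` killed by the differential splits off together with a copy of it in
the preceding degree. -/
theorem exists_idempotent {i j k : ℤ} (hij : i + 1 = j) (hjk : j + 1 = k) (p : C.X j →ₗ[Λ] C.X j)
    (hp : ∀ x, p (p x) = p x) (hdp : ∀ x, C.d j k hjk (p x) = 0) :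
    ∃ e : ∀ i, C.X i →ₗ[Λ] C.X i, (∀ i x, e i (e i x) = e i x) ∧
      (∀ i j h x, C.d i j h (e i x) = e j (C.d i j h x)) ∧
      e j = LinearMap.id - p ∧ ∀ l, l ≠ i → l ≠ j → e l = LinearMap.id := by
  obtain ⟨s', hs'⟩ := (C.projective j).exists_lift p (C.d i j hij) fun x =>
    (C.exact i j k hij hjk _).1 (hdp x)
  -- Precomposing with `p` gives `s p = s`, which makes `s d` idempotent.
  let s := s'.comp p
  have hs : ∀ x, C.d i j hij (s x) = p x := fun x => by simp [s, hs', hp]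
  have hsp : ∀ x, s (p x) = s x := fun x => by simp [s, hp]
  let e : ∀ i, C.X i →ₗ[Λ] C.X i := Function.update (Function.update (fun _ => LinearMap.id) i
    (LinearMap.id - s.comp (C.d i j hij))) j (LinearMap.id - p)
  have hne : i ≠ j := by omega
  have ej : e j = LinearMap.id - p := Function.update_self _ _ _
  have ei : e i = LinearMap.id - s.comp (C.d i j hij) := by
    simp only [e]
    rw [Function.update_of_ne hne, Function.update_self]
  have el : ∀ l, l ≠ i → l ≠ j → e l = LinearMap.id := fun l h h' => by
    simp only [e]
    rw [Function.update_of_ne h', Function.update_of_ne h]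
  refine ⟨e, fun l x => ?_, fun a b hab x => ?_, ej, el⟩
  · by_cases hl : l = j
    · subst hl
      simp [ej, hp]
    by_cases hl' : l = i
    · subst hl'
      simp [ei, hs, hsp]
    · simp [el l hl' hl]
  · by_cases ha : a = i
    · subst ha
      obtain rfl : b = j := by omega
      simp [ei, ej, hs]
    by_cases ha' : a = j
    · subst ha'
      obtain rfl : b = k := by omega
      rw [ej, el b (by omega) (by omega)]
      simp [hdp]
    by_cases hb : b = i
    · subst hb
      rw [ei, el a ha ha']
      simp [C.d_d]
    · rw [el a ha ha', el b hb (by omega)]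
      rfl

end CompleteResolution

/-! ### Minimal presentations inside complete resolutions -/

/-- If no nonzero direct summand of a projective module of finite length lies in the kernel of `g`,
then the kernel of `g` is superfluous. -/
theorem isSuperfluous_ker_of_idempotent {Λ : Type u} [Ring Λ] {P : Type w} {M : Type*}
    [AddCommGroup P] [Module Λ P] [AddCommGroup M] [Module Λ M] [IsArtinian Λ P] [IsNoetherian Λ P]
    (hP : Module.Projective Λ P) (g : P →ₗ[Λ] M)
    (h : ∀ p : P →ₗ[Λ] P, (∀ x, p (p x) = p x) → (∀ x, g (p x) = 0) → p = 0) :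
    IsSuperfluous (LinearMap.ker g) := by
  intro L hL
  obtain ⟨t, ht⟩ := hP.exists_lift g (g.comp L.subtype) fun x => by
    obtain ⟨y, hy, z, hz, rfl⟩ := Submodule.mem_sup.1 (hL ▸ Submodule.mem_top : x ∈ L ⊔ _)
    exact ⟨⟨y, hy⟩, by simp [LinearMap.mem_ker.1 hz]⟩
  let T : Module.End Λ P := L.subtype.comp t
  have hT : ∀ x, g (T x) = g x := ht
  have hTn : ∀ n x, g ((T ^ n) x) = g x := fun n => by
    induction n with
    | zero => intro x; rfl
    | succ n ih => intro x; rw [pow_succ, Module.End.mul_apply, ih, hT]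
  -- Fitting's lemma: for large powers `P = ker Tⁿ ⊕ Im Tⁿ`. The first summand lies in `ker g` since
  -- `g Tⁿ = g`, so it is zero. The exponent `n + 1` is positive, which puts the image inside `L`.
  obtain ⟨n, hn⟩ := Filter.eventually_atTop.1 T.eventually_isCompl_ker_pow_range_pow
  have hc := hn (n + 1) n.le_succ
  have hp0 := h (Submodule.projection _ _ hc)
    (fun x => Submodule.projection_apply_left hc ⟨_, Submodule.projection_apply_mem hc x⟩)
    fun x => by
      rw [← hTn (n + 1), LinearMap.mem_ker.1 (Submodule.projection_apply_mem hc x), map_zero]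
  rw [eq_top_iff]
  intro x _
  have hx := (Submodule.projection_apply_eq_zero_iff hc).1 (LinearMap.congr_fun hp0 x)
  obtain ⟨y, rfl⟩ := hx
  rw [pow_succ', Module.End.mul_apply]
  exact (t _).2

namespace CompleteResolution

variable {Λ : Type u} [Ring Λ] [IsArtinianRing Λ]

/-- A Gorenstein projective module over an artinian ring has a complete resolution that contains a
minimal projective presentation of it. -/
theorem exists_minimal_isCokernel {M : Type u} [AddCommGroup M] [Module Λ M]
    (hM : IsGorensteinProjective Λ M) :
    ∃ (C : CompleteResolution Λ) (i j : ℤ) (h : i + 1 = j) (g : C.X j →ₗ[Λ] M),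
      C.IsCokernel h g ∧ IsSuperfluous (LinearMap.ker g) ∧
        IsSuperfluous (LinearMap.ker (C.d i j h)) := by
  obtain ⟨C, i, j, h, g, hg⟩ := exists_isCokernel hM
  -- Induction on the total length of the two terms: a failure of minimality yields a contractible
  -- summand to discard, and the length drops.
  suffices H : ∀ (n : ℕ∞) (C : CompleteResolution Λ) (i j : ℤ) (h : i + 1 = j) (g : C.X j →ₗ[Λ] M),
      C.IsCokernel h g → Module.length Λ (C.X i) + Module.length Λ (C.X j) = n →
      ∃ (C : CompleteResolution Λ) (i j : ℤ) (h : i + 1 = j) (g : C.X j →ₗ[Λ] M),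
      C.IsCokernel h g ∧ IsSuperfluous (LinearMap.ker g) ∧
        IsSuperfluous (LinearMap.ker (C.d i j h)) from H _ C i j h g hg rfl
  intro n
  induction n using WellFoundedLT.induction with
  | ind n ih =>
  rintro C i j h g hg rfl
  have hfin := C.finite
  have hart : ∀ l, IsArtinian Λ (C.X l) := fun l => inferInstance
  have hnoe : ∀ l, IsNoetherian Λ (C.X l) := fun l => inferInstance
  by_contra hcon
  have hle : ∀ {l} (e : C.X l →ₗ[Λ] C.X l),
      Module.length Λ (LinearMap.range e) ≤ Module.length Λ (C.X l) := fun e =>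
    Module.length_le_of_injective (Submodule.subtype _) (Submodule.subtype_injective _)
  have hlt : ∀ {l} {p : C.X l →ₗ[Λ] C.X l}, (∀ x, p (p x) = p x) → p ≠ 0 →
      Module.length Λ (LinearMap.range (LinearMap.id - p)) < Module.length Λ (C.X l) := by
    intro l p hp hp0
    refine Submodule.length_lt fun htop => hp0 (LinearMap.ext fun x => ?_)
    obtain ⟨y, rfl⟩ := LinearMap.range_eq_top.1 htop x
    simp [hp]
  refine hcon ⟨C, i, j, h, g, hg, ?_, ?_⟩
  · refine isSuperfluous_ker_of_idempotent (C.projective j) g fun p hp hgp => ?_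
    by_contra hp0
    obtain ⟨e, he, hd, hej, -⟩ := exists_idempotent h rfl p hp fun x => by
      obtain ⟨y, hy⟩ := (hg.exact _).1 (hgp x)
      rw [← hy, C.d_d]
    refine hcon (ih _ ?_ _ i j h _ (hg.ofIdempotent he hd fun x => by simp [hej, hgp]) rfl)
    refine ENat.add_lt_add_of_le_of_lt ?_ (hle (e i)) ?_
    · exact ne_top_of_le_ne_top Module.length_ne_top (hle (e i))
    · change Module.length Λ (LinearMap.range (e j)) < _
      rw [hej]
      exact hlt hp hp0
  · refine isSuperfluous_ker_of_idempotent (C.projective i) _ fun p hp hgp => ?_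
    by_contra hp0
    -- The second copy of the summand sits in degree `i - 1`, so degree `j` is untouched.
    obtain ⟨e, he, hd, hei, hel⟩ := exists_idempotent (i := i - 1) (by ring) h p hp hgp
    have hej := hel j (by omega) (by omega)
    refine hcon (ih _ ?_ _ i j h _ (hg.ofIdempotent he hd fun x => by simp [hej]) rfl)
    refine ENat.add_lt_add_of_lt_of_le ?_ ?_ (hle (e j))
    · exact ne_top_of_le_ne_top Module.length_ne_top (hle (e j))
    · change Module.length Λ (LinearMap.range (e i)) < _
      rw [hei]
      exact hlt hp hp0

end CompleteResolution

/-! ### The criterion in terms of differentials -/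

/-- An intrinsic form of CM-`τ`-tilting freeness: every rigid differential of a complete resolution
is von Neumann regular. -/
theorem isCMTauTiltingFree_iff (K : Type v) [Field K] (Λ : Type u) [Ring Λ] [Algebra K Λ]
    [FiniteDimensional K Λ] :
    IsCMTauTiltingFree K Λ ↔ ∀ (C : CompleteResolution Λ) (i j : ℤ) (h : i + 1 = j),
      IsRigidMap (C.d i j h) → IsRegularMap (C.d i j h) := by
  have : IsArtinianRing Λ := IsArtinianRing.of_finite K Λ
  constructor
  · intro H C i j h hr
    have hg := C.isCokernel_mkQ h
    refine .of_projective (C.projective j) hg.exact hg.surjective (H _ ?_ ?_ ?_)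
    · have := C.finite j
      infer_instance
    · exact hg.isGorensteinProjective
    -- The given differential need not be a minimal presentation; factorization is transferred to a
    -- minimal one, which computes `τ`.
    · obtain ⟨C', i', j', h', g', hg', hs₀, hs₁⟩ :=
        CompleteResolution.exists_minimal_isCokernel hg.isGorensteinProjective
      refine ⟨C'.X i', C'.X j', inferInstance, inferInstance, inferInstance, inferInstance,
        C'.d i' j' h', g', ⟨C'.finite _, C'.finite _, C'.projective _, C'.projective _,
        hg'.exact, hg'.surjective, hs₀, hs₁⟩, ?_⟩
      rw [hom_arTranslate_eq_zero_iff K (C'.dualBasis _) (C'.dualBasis _)]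
      refine .of_superfluous (C.projective i) (C.projective j) (C'.projective _) (C'.projective _)
        hg.exact hg.surjective hg'.exact hg'.surjective hs₁ ?_
      exact (isRigidMap_iff_mapsFactorThrough (C.projective _) (C.projective _) hg.exact
        hg.surjective).1 hr
  · intro H M _ _ _ hM hτ
    obtain ⟨P₁, P₀, _, _, _, _, f, g, hfg, hh⟩ := hτ
    rw [hom_arTranslate_eq_zero_iff K (.of_finite_projective hfg.finite₁ hfg.projective₁)
      (.of_finite_projective hfg.finite₀ hfg.projective₀)] at hh
    obtain ⟨C, i, j, h, g', hg', hs₀, hs₁⟩ := CompleteResolution.exists_minimal_isCokernel hM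
    refine (H C i j h ?_).projective (C.projective j) hg'.exact hg'.surjective
    rw [isRigidMap_iff_mapsFactorThrough (C.projective _) (C.projective _) hg'.exact
      hg'.surjective]
    exact .of_superfluous hfg.projective₁ hfg.projective₀ (C.projective _) (C.projective _)
      hfg.exact hfg.surjective hg'.exact hg'.surjective hs₁ hh

/-! ### Duality and the opposite algebra -/

section Duality

variable {Λ : Type u} [Ring Λ] {P Q : Type w} [AddCommGroup P] [Module Λ P]
  [AddCommGroup Q] [Module Λ Q]

@[simp]
theorem starMap_apply_apply (f : P →ₗ[Λ] Q) (φ : Q →ₗ[Λ] Λ) (x : P) : starMap f φ x = φ (f x) :=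
  rfl

theorem HasFiniteDualBasis.eq_of_forall_dual (hP : HasFiniteDualBasis Λ P) {x y : P}
    (h : ∀ φ : P →ₗ[Λ] Λ, φ x = φ y) : x = y := by
  obtain ⟨n, q, φ, hφ⟩ := hP
  rw [← hφ x, ← hφ y]
  simp only [h]

theorem HasFiniteDualBasis.dual (hP : HasFiniteDualBasis Λ P) :
    HasFiniteDualBasis Λᵐᵒᵖ (P →ₗ[Λ] Λ) := by
  obtain ⟨n, q, φ, hφ⟩ := hP
  refine ⟨n, φ, fun j =>
    { toFun := fun ξ => MulOpposite.op (ξ (q j))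
      map_add' := fun _ _ => rfl
      map_smul' := fun _ _ => rfl }, fun ξ => LinearMap.ext fun x => ?_⟩
  conv_rhs => rw [← hφ x]
  simp

/-- Finitely generated projective modules are reflexive. -/
theorem HasFiniteDualBasis.exists_eq_eval (hP : HasFiniteDualBasis Λ P)
    (ξ : (P →ₗ[Λ] Λ) →ₗ[Λᵐᵒᵖ] Λᵐᵒᵖ) : ∃ x : P, ∀ φ, ξ φ = MulOpposite.op (φ x) := by
  obtain ⟨n, q, φ, hφ⟩ := hP
  refine ⟨∑ j, (ξ (φ j)).unop • q j, fun ψ => ?_⟩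
  have : ψ = ∑ j, MulOpposite.op (ψ (q j)) • φ j := by
    ext x
    conv_lhs => rw [← hφ x]
    simp
  conv_lhs => rw [this]
  simp

/-- Duality on finitely generated projective modules is full. -/
theorem HasFiniteDualBasis.exists_eq_starMap (hQ : HasFiniteDualBasis Λ Q)
    (α : (Q →ₗ[Λ] Λ) →ₗ[Λᵐᵒᵖ] (P →ₗ[Λ] Λ)) : ∃ a : P →ₗ[Λ] Q, starMap a = α := by
  obtain ⟨n, q, φ, hφ⟩ := hQ
  refine ⟨∑ j, (α (φ j)).smulRight (q j), LinearMap.ext fun ψ => LinearMap.ext fun x => ?_⟩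
  have : ψ = ∑ j, MulOpposite.op (ψ (q j)) • φ j := by
    ext x
    conv_lhs => rw [← hφ x]
    simp
  conv_rhs => rw [this]
  simp

/-- Dualizing `f β + γ f` gives `β* f* + f* γ*`, with the roles of `β` and `γ` exchanged; by
fullness every map `Q* → P*` is a dual. -/
theorem IsRigidMap.starMap {f : P →ₗ[Λ] Q} (hf : IsRigidMap f) (hQ : HasFiniteDualBasis Λ Q) :
    IsRigidMap (starMap f) := by
  intro α
  obtain ⟨a, rfl⟩ := hQ.exists_eq_starMap α
  obtain ⟨β, γ, h⟩ := hf a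
  refine ⟨_root_.starMap γ, _root_.starMap β, fun φ => LinearMap.ext fun x => ?_⟩
  simp [h, add_comm]

theorem IsRegularMap.of_starMap {f : P →ₗ[Λ] Q} (hf : IsRegularMap (starMap f))
    (hP : HasFiniteDualBasis Λ P) (hQ : HasFiniteDualBasis Λ Q) : IsRegularMap f := by
  obtain ⟨s, hs⟩ := hf
  obtain ⟨t, rfl⟩ := hP.exists_eq_starMap s
  exact ⟨t, fun x => hQ.eq_of_forall_dual fun φ => LinearMap.congr_fun (hs φ) x⟩

/-- The dual complete resolution. -/
def CompleteResolution.dual (C : CompleteResolution Λ) : CompleteResolution Λᵐᵒᵖ where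
  X i := C.X (-i) →ₗ[Λ] Λ
  d i j h := starMap (C.d (-j) (-i) (by omega))
  dualBasis i := (C.dualBasis _).dual
  exact i j k hij hjk := C.dual_exact' _ _
  dual_exact i j k hij hjk ξ hξ := by
    -- By reflexivity `ξ` is evaluation at some `x`, which is a cycle; evaluation at a preimage `y`
    -- of `x` extends `ξ`.
    obtain ⟨x, hx⟩ := (C.dualBasis _).exists_eq_eval ξ
    obtain ⟨y, rfl⟩ := (C.exact (-k) (-j) (-i) (by omega) (by omega) x).1 <|
      (C.dualBasis _).eq_of_forall_dual fun φ => by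
        have := LinearMap.congr_fun hξ φ
        rw [LinearMap.comp_apply, hx] at this
        simpa using this
    refine ⟨{ toFun := fun φ => MulOpposite.op (φ y)
              map_add' := fun _ _ => rfl
              map_smul' := fun _ _ => rfl }, LinearMap.ext fun φ => (hx φ).symm⟩

/-- Regularity of rigid differentials passes from the opposite ring. -/
theorem isRegularMap_of_opposite
    (H : ∀ (C : CompleteResolution Λᵐᵒᵖ) (i j : ℤ) (h : i + 1 = j),
      IsRigidMap (C.d i j h) → IsRegularMap (C.d i j h))
    (C : CompleteResolution Λ) (i j : ℤ) (h : i + 1 = j) (hC : IsRigidMap (C.d i j h)) :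
    IsRegularMap (C.d i j h) := by
  obtain ⟨a, rfl⟩ : ∃ a, i = -a := ⟨-i, by ring⟩
  obtain ⟨b, rfl⟩ : ∃ b, j = -b := ⟨-j, by ring⟩
  exact (H C.dual b a (by omega) (hC.starMap (C.dualBasis _))).of_starMap
    (C.dualBasis _) (C.dualBasis _)

end Duality

/-! ### Restriction along a surjective ring map -/

section Restriction

variable {T : Type u} {Λ : Type u} [Ring T] [Ring Λ] {M N : Type*} [AddCommGroup M] [Module T M]
  [Module Λ M] [AddCommGroup N] [Module T N] [Module Λ N]

/-- A `Λ`-linear map is linear over `T`, if `T` acts through `π : T → Λ`. -/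
def LinearMap.restrictAlong (π : T →+* Λ) (hM : ∀ t (x : M), π t • x = t • x)
    (hN : ∀ t (x : N), π t • x = t • x) (f : M →ₗ[Λ] N) : M →ₗ[T] N where
  toFun := f
  map_add' := map_add f
  map_smul' t x := by rw [← hM, map_smul, hN, RingHom.id_apply]

/-- A `T`-linear map is linear over `Λ`, if `T` acts through a surjection `π : T → Λ`. -/
def LinearMap.extendAlong (π : T →+* Λ) (hπ : Function.Surjective π)
    (hM : ∀ t (x : M), π t • x = t • x) (hN : ∀ t (x : N), π t • x = t • x) (f : M →ₗ[T] N) :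
    M →ₗ[Λ] N where
  toFun := f
  map_add' := map_add f
  map_smul' a x := by
    obtain ⟨t, rfl⟩ := hπ a
    rw [hM, map_smul, ← hN, RingHom.id_apply]

theorem IsRigidMap.restrictAlong {π : T →+* Λ} (hπ : Function.Surjective π)
    (hM : ∀ t (x : M), π t • x = t • x) (hN : ∀ t (x : N), π t • x = t • x) {f : M →ₗ[Λ] N}
    (hf : IsRigidMap f) : IsRigidMap (f.restrictAlong π hM hN) := by
  intro α
  obtain ⟨β, γ, h⟩ := hf (α.extendAlong π hπ hM hN)
  exact ⟨β.restrictAlong π hM hM, γ.restrictAlong π hN hN, h⟩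

theorem IsRegularMap.of_restrictAlong {π : T →+* Λ} (hπ : Function.Surjective π)
    {hM : ∀ t (x : M), π t • x = t • x} {hN : ∀ t (x : N), π t • x = t • x} {f : M →ₗ[Λ] N}
    (hf : IsRegularMap (f.restrictAlong π hM hN)) : IsRegularMap f := by
  obtain ⟨s, hs⟩ := hf
  exact ⟨s.extendAlong π hπ hN hM, hs⟩

/-- Data which show that restriction along `π : T → Λ` preserves complete resolutions: a `T`-linear
section of `π`, and an isomorphism of the annihilator of `ker π` in `T` with a summand of some
`Λⁿ`. -/
structure RestrictionData (π : T →+* Λ) where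
  sec : Λ →+ T
  sec_mul : ∀ t a, sec (π t * a) = t * sec a
  π_sec : ∀ a, π (sec a) = a
  n : ℕ
  coord : Fin n → T →+ Λ
  coord_mul : ∀ k t s, (∀ a, π a = 0 → a * s = 0) → coord k (t * s) = π t * coord k s
  incl : Fin n → Λ →+ T
  incl_mul : ∀ k t a, incl k (π t * a) = t * incl k a
  sum_incl_coord : ∀ s, (∀ a, π a = 0 → a * s = 0) → ∑ k, incl k (coord k s) = s

theorem RestrictionData.surjective {π : T →+* Λ} (D : RestrictionData π) :
    Function.Surjective π := fun a => ⟨D.sec a, D.π_sec a⟩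

/-- Restriction of a complete resolution along `π`. -/
def CompleteResolution.restrict {π : T →+* Λ} (D : RestrictionData π)
    (C : CompleteResolution Λ) : CompleteResolution T :=
  letI : ∀ i, Module T (C.X i) := fun i => Module.compHom (C.X i) π
  { X := C.X
    module := this
    d := fun i j h => (C.d i j h).restrictAlong π (fun _ _ => rfl) fun _ _ => rfl
    dualBasis := fun i => by
      obtain ⟨n, q, φ, hφ⟩ := C.dualBasis i
      refine ⟨n, q, fun j =>
        { toFun := fun x => D.sec (φ j x)
          map_add' := fun x y => by rw [map_add, map_add]
          map_smul' := fun t x => (congrArg D.sec (map_smul (φ j) (π t) x)).trans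
            (D.sec_mul t (φ j x)) }, fun x => ?_⟩
      refine Eq.trans (Finset.sum_congr rfl fun j _ => ?_) (hφ x)
      change π (D.sec (φ j x)) • q j = φ j x • q j
      rw [D.π_sec]
    exact := fun i j k hij hjk => C.exact i j k hij hjk
    dual_exact := fun i j k hij hjk φ hφ => by
      -- The values of `φ` lie in the annihilator of `ker π`, so `φ` splits into `Λ`-linear
      -- coordinates. Each extends over `Λ`, and `incl` reassembles them.
      have hann : ∀ x a, π a = 0 → a * φ x = 0 := fun x a ha => by
        rw [← smul_eq_mul, ← map_smul]
        change φ (π a • x) = 0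
        rw [ha, zero_smul, map_zero]
      have key : ∀ l, ∃ ψ : C.X k →ₗ[Λ] Λ, ∀ x, ψ (C.d j k hjk x) = D.coord l (φ x) := fun l => by
        obtain ⟨ψ, hψ⟩ := C.dual_exact i j k hij hjk
          { toFun := fun x => D.coord l (φ x)
            map_add' := fun x y => by rw [map_add, map_add]
            map_smul' := fun a x => by
              obtain ⟨t, rfl⟩ := D.surjective a
              exact (congrArg (D.coord l) (map_smul φ t x)).trans
                (D.coord_mul l t (φ x) (hann x)) } <| LinearMap.ext fun x =>
            (congrArg (D.coord l) (LinearMap.congr_fun hφ x)).trans (map_zero _)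
        exact ⟨ψ, LinearMap.congr_fun hψ⟩
      choose ψ hψ using key
      refine ⟨{ toFun := fun x => ∑ l, D.incl l (ψ l x)
                map_add' := fun x y => by simp [Finset.sum_add_distrib]
                map_smul' := fun t x => ?_ }, LinearMap.ext fun x => ?_⟩
      · rw [RingHom.id_apply, Finset.smul_sum]
        refine Finset.sum_congr rfl fun l _ => ?_
        exact (congrArg (D.incl l) (map_smul (ψ l) (π t) x)).trans (D.incl_mul l t (ψ l x))
      · change ∑ l, D.incl l (ψ l (C.d j k hjk x)) = φ x
        refine Eq.trans (Finset.sum_congr rfl fun l _ => ?_) (D.sum_incl_coord (φ x) (hann x))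
        exact congrArg (D.incl l) (hψ l x) }

/-- Regularity of rigid differentials passes from `T` to `Λ`. -/
theorem RestrictionData.isRegularMap {π : T →+* Λ} (D : RestrictionData π)
    (H : ∀ (C : CompleteResolution T) (i j : ℤ) (h : i + 1 = j),
      IsRigidMap (C.d i j h) → IsRegularMap (C.d i j h))
    (C : CompleteResolution Λ) (i j : ℤ) (h : i + 1 = j) (hC : IsRigidMap (C.d i j h)) :
    IsRegularMap (C.d i j h) :=
  letI : ∀ i, Module T (C.X i) := fun i => Module.compHom (C.X i) π
  .of_restrictAlong D.surjective (hM := fun _ _ => rfl) (hN := fun _ _ => rfl) <|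
    H (C.restrict D) i j h (hC.restrictAlong D.surjective (fun _ _ => rfl) fun _ _ => rfl)

/-- Restriction along a ring isomorphism. -/
def RestrictionData.ofRingEquiv (e : T ≃+* Λ) : RestrictionData (e : T →+* Λ) where
  sec := e.symm
  sec_mul t a := by simp
  π_sec a := by simp
  n := 1
  coord _ := e
  coord_mul _ t s _ := by simp
  incl _ := e.symm
  incl_mul _ t a := by simp
  sum_incl_coord s _ := by simp

end Restriction

/-- The forward implication applies duality to `Λᵐᵒᵖ` and identifies the double opposite with `Λ`.
-/
theorem isCMTauTiltingFree_opposite_iff (K : Type v) [Field K] (Λ : Type u) [Ring Λ] [Algebra K Λ]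
    [FiniteDimensional K Λ] : IsCMTauTiltingFree K Λ ↔ IsCMTauTiltingFree K Λᵐᵒᵖ := by
  rw [isCMTauTiltingFree_iff, isCMTauTiltingFree_iff]
  exact ⟨fun H => isRegularMap_of_opposite
    ((RestrictionData.ofRingEquiv (RingEquiv.opOp Λ)).isRegularMap H),
    isRegularMap_of_opposite⟩

/-! ### Reduction along a split surjection -/

/-- Simultaneous lifting of two semilinear maps from a finitely generated projective module. -/
theorem HasFiniteDualBasis.exists_lift₂ {T Λ Λ' : Type*} [Ring T] [Ring Λ] [Ring Λ']
    {π : T →+* Λ} {π' : T →+* Λ'} {P M N N' : Type*} [AddCommGroup P] [Module T P]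
    [AddCommGroup M] [Module T M] [AddCommGroup N] [Module Λ N] [AddCommGroup N'] [Module Λ' N']
    (hP : HasFiniteDualBasis T P) (a : P →ₛₗ[π] N) (a' : P →ₛₗ[π'] N') (b : M →ₛₗ[π] N)
    (b' : M →ₛₗ[π'] N') (h : ∀ x, ∃ y, b y = a x ∧ b' y = a' x) :
    ∃ c : P →ₗ[T] M, ∀ x, b (c x) = a x ∧ b' (c x) = a' x := by
  obtain ⟨n, q, φ, hφ⟩ := hP
  choose y hy hy' using fun j => h (q j)
  refine ⟨∑ j, (φ j).smulRight (y j), fun x => ?_⟩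
  conv => enter [1, 2]; rw [← hφ x]
  conv => enter [2, 2]; rw [← hφ x]
  simp [hy, hy', LinearMap.map_smulₛₗ]

/-- A surjective ring homomorphism `π : T → Λ` with a section `δ`. -/
structure SplitSurjection (T Λ : Type*) [Ring T] [Ring Λ] where
  π : T →+* Λ
  δ : Λ →+* T
  π_δ : ∀ a, π (δ a) = a

namespace SplitSurjection

section Reduction

variable {T Λ : Type*} [Ring T] [Ring Λ] (σ : SplitSurjection T Λ)
  {M N : Type*} [AddCommGroup M] [Module T M] [AddCommGroup N] [Module T N]

variable (M) in
/-- The submodule `(ker π) M`. -/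
def kerSMul : Submodule T M := Submodule.span T {x | ∃ a m, σ.π a = 0 ∧ a • m = x}

variable (M) in
/-- The reduction `M / (ker π) M`, as a `Λ`-module. -/
def Red : Type _ := M ⧸ σ.kerSMul M

instance : AddCommGroup (σ.Red M) := inferInstanceAs (AddCommGroup (M ⧸ σ.kerSMul M))

instance : Module Λ (σ.Red M) := Module.compHom (M ⧸ σ.kerSMul M) σ.δ

/-- The projection `M → M / (ker π) M`. -/
def proj : M →ₛₗ[σ.π] σ.Red M where
  toFun x := (Submodule.Quotient.mk x : M ⧸ σ.kerSMul M)
  map_add' _ _ := rfl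
  map_smul' t x := by
    change (Submodule.Quotient.mk (t • x) : M ⧸ σ.kerSMul M) =
      Submodule.Quotient.mk (σ.δ (σ.π t) • x)
    rw [Submodule.Quotient.eq, ← sub_smul]
    exact Submodule.subset_span ⟨_, x, by simp [σ.π_δ], rfl⟩

theorem proj_surjective : Function.Surjective (σ.proj : M →ₛₗ[σ.π] σ.Red M) :=
  Submodule.Quotient.mk_surjective _

theorem proj_eq_zero {x : M} : σ.proj x = 0 ↔ x ∈ σ.kerSMul M :=
  Submodule.Quotient.mk_eq_zero _

theorem proj_smul_eq_zero {a : T} (ha : σ.π a = 0) (x : M) : σ.proj (a • x) = 0 := by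
  rw [LinearMap.map_smulₛₗ, ha, zero_smul]

/-- Semilinear maps factor through the reduction. -/
def lift {N : Type*} [AddCommGroup N] [Module Λ N] (f : M →ₛₗ[σ.π] N) : σ.Red M →ₗ[Λ] N where
  toFun := (σ.kerSMul M).liftQ f <| Submodule.span_le.2 <| by
    rintro _ ⟨a, m, ha, rfl⟩
    simp [LinearMap.map_smulₛₗ, ha]
  map_add' := map_add _
  map_smul' a x := by
    refine (LinearMap.map_smulₛₗ _ (σ.δ a) (show M ⧸ σ.kerSMul M from x)).trans ?_
    rw [σ.π_δ, RingHom.id_apply]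

@[simp]
theorem lift_proj {N : Type*} [AddCommGroup N] [Module Λ N] (f : M →ₛₗ[σ.π] N) (x : M) :
    σ.lift f (σ.proj x) = f x :=
  rfl

/-- The map on reductions induced by a linear map. -/
def map (f : M →ₗ[T] N) : σ.Red M →ₗ[Λ] σ.Red N := σ.lift (σ.proj.comp f)

@[simp]
theorem map_proj (f : M →ₗ[T] N) (x : M) : σ.map f (σ.proj x) = σ.proj (f x) :=
  rfl

theorem hasFiniteDualBasis_red (hM : HasFiniteDualBasis T M) :
    HasFiniteDualBasis Λ (σ.Red M) := by
  obtain ⟨n, q, φ, hφ⟩ := hM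
  refine ⟨n, fun j => σ.proj (q j), fun j => σ.lift
    { toFun := fun x => σ.π (φ j x)
      map_add' := fun x y => by simp
      map_smul' := fun t x => by simp }, fun x => ?_⟩
  obtain ⟨x, rfl⟩ := σ.proj_surjective x
  conv_rhs => rw [← hφ x]
  simp [LinearMap.map_smulₛₗ]

/-- A map between the reductions lifts to `M → N`, and the reduction of its decomposition decomposes
the original map. -/
theorem isRigidMap_map (hM : HasFiniteDualBasis T M) {f : M →ₗ[T] N} (hf : IsRigidMap f) :
    IsRigidMap (σ.map f) := by
  intro α
  have hα : ∀ x, ∃ y, σ.proj y = (α.comp σ.proj) x := fun x => σ.proj_surjective _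
  obtain ⟨c, hc⟩ := hM.exists_lift₂ (α.comp σ.proj) (α.comp σ.proj) σ.proj σ.proj
    fun x => by simpa using hα x
  obtain ⟨β, γ, h⟩ := hf c
  refine ⟨σ.map β, σ.map γ, fun x => ?_⟩
  obtain ⟨x, rfl⟩ := σ.proj_surjective x
  have := (hc x).1
  rw [LinearMap.comp_apply] at this
  rw [← this, h, map_add, map_proj, map_proj, map_proj, map_proj]

end Reduction

/-- The reduction of a complete resolution, if it is totally acyclic. -/
def redResolution {T Λ : Type u} [Ring T] [Ring Λ] (σ : SplitSurjection T Λ)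
    (C : CompleteResolution T)
    (hex : ∀ i j k (hij : i + 1 = j) (hjk : j + 1 = k) (x : C.X j),
      σ.proj (C.d j k hjk x) = 0 → ∃ y, σ.proj (C.d i j hij y) = σ.proj x)
    (hdual : ∀ i j k (hij : i + 1 = j) (hjk : j + 1 = k) (φ : C.X j →ₛₗ[σ.π] Λ),
      (∀ x, φ (C.d i j hij x) = 0) →
        ∃ ψ : C.X k →ₛₗ[σ.π] Λ, ∀ x, ψ (C.d j k hjk x) = φ x) :
    CompleteResolution Λ where
  X i := σ.Red (C.X i)
  d i j h := σ.map (C.d i j h)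
  dualBasis i := σ.hasFiniteDualBasis_red (C.dualBasis i)
  exact i j k hij hjk x := by
    obtain ⟨x, rfl⟩ := σ.proj_surjective x
    constructor
    · intro h
      obtain ⟨y, hy⟩ := hex i j k hij hjk x h
      exact ⟨σ.proj y, hy⟩
    · rintro ⟨y, hy⟩
      obtain ⟨y, rfl⟩ := σ.proj_surjective y
      rw [← hy, map_proj, map_proj, C.d_d, map_zero]
  dual_exact i j k hij hjk φ hφ := by
    obtain ⟨ψ, hψ⟩ := hdual i j k hij hjk (φ.comp σ.proj) fun x =>
      LinearMap.congr_fun hφ (σ.proj x)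
    refine ⟨σ.lift ψ, LinearMap.ext fun x => ?_⟩
    obtain ⟨x, rfl⟩ := σ.proj_surjective x
    exact hψ x

end SplitSurjection

/-! ### Triangular matrices and their modules -/

namespace T₂

variable (K : Type v) {Λ : Type u} [Field K] [Ring Λ] [Algebra K Λ]

/-- The lower triangular matrix with rows `(a, 0)` and `(b, c)`. -/
def mat (a b c : Λ) : T₂ K Λ := ⟨!![a, 0; b, c], rfl⟩

variable {K}

theorem exists_eq_mat (t : T₂ K Λ) : ∃ a b c, t = mat K a b c := by
  obtain ⟨t, ht⟩ := t
  refine ⟨t 0 0, t 1 0, t 1 1, Subtype.ext ?_⟩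
  have ht : t 0 1 = 0 := ht
  ext i j
  fin_cases i <;> fin_cases j <;> simp [mat, ht]

@[simp]
theorem mat_mul (a b c a' b' c' : Λ) :
    mat K a b c * mat K a' b' c' = mat K (a * a') (b * a' + c * b') (c * c') := by
  refine Subtype.ext ?_
  simp [mat]

@[simp]
theorem mat_add (a b c a' b' c' : Λ) :
    mat K a b c + mat K a' b' c' = mat K (a + a') (b + b') (c + c') := by
  refine Subtype.ext ?_
  simp [mat]

@[simp]
theorem mat_sub (a b c a' b' c' : Λ) :
    mat K a b c - mat K a' b' c' = mat K (a - a') (b - b') (c - c') := by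
  rw [sub_eq_iff_eq_add, mat_add]
  simp

theorem one_eq_mat : (1 : T₂ K Λ) = mat K 1 0 1 := by
  refine Subtype.ext ?_
  simp [mat, Matrix.one_fin_two]

theorem zero_eq_mat : (0 : T₂ K Λ) = mat K 0 0 0 := by
  refine Subtype.ext ?_
  ext i j
  fin_cases i <;> fin_cases j <;> simp [mat]

variable (K Λ)

/-- The diagonal embedding. -/
def diag : Λ →+* T₂ K Λ where
  toFun a := mat K a 0 a
  map_one' := one_eq_mat.symm
  map_mul' _ _ := by simp
  map_zero' := zero_eq_mat.symm
  map_add' _ _ := by simp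

/-- The projection to the upper left entry. -/
def upper : SplitSurjection (T₂ K Λ) Λ where
  π :=
    { toFun := fun t => t.1 0 0
      map_one' := by simp
      map_mul' := fun s t => by
        obtain ⟨a, b, c, rfl⟩ := exists_eq_mat s
        obtain ⟨a', b', c', rfl⟩ := exists_eq_mat t
        rw [mat_mul]
        rfl
      map_zero' := rfl
      map_add' := fun _ _ => rfl }
  δ := diag K Λ
  π_δ _ := rfl

/-- The projection to the lower right entry. -/
def lower : SplitSurjection (T₂ K Λ) Λ where
  π :=
    { toFun := fun t => t.1 1 1
      map_one' := by simp
      map_mul' := fun s t => by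
        obtain ⟨a, b, c, rfl⟩ := exists_eq_mat s
        obtain ⟨a', b', c', rfl⟩ := exists_eq_mat t
        rw [mat_mul]
        rfl
      map_zero' := rfl
      map_add' := fun _ _ => rfl }
  δ := diag K Λ
  π_δ _ := rfl

/-- The lower left entry. -/
def corner : T₂ K Λ →+ Λ where
  toFun t := t.1 1 0
  map_zero' := rfl
  map_add' _ _ := rfl

variable {K Λ}

@[simp] theorem upper_mat (a b c : Λ) : (upper K Λ).π (mat K a b c) = a := rfl

@[simp] theorem lower_mat (a b c : Λ) : (lower K Λ).π (mat K a b c) = c := rfl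

@[simp] theorem corner_mat (a b c : Λ) : corner K Λ (mat K a b c) = b := rfl

theorem mat_entries (t : T₂ K Λ) :
    mat K ((upper K Λ).π t) (corner K Λ t) ((lower K Λ).π t) = t := by
  obtain ⟨a, b, c, rfl⟩ := exists_eq_mat t
  rfl

theorem corner_mul (s t : T₂ K Λ) : corner K Λ (s * t) =
    corner K Λ s * (upper K Λ).π t + (lower K Λ).π s * corner K Λ t := by
  obtain ⟨a, b, c, rfl⟩ := exists_eq_mat s
  obtain ⟨a', b', c', rfl⟩ := exists_eq_mat t
  simp

theorem mul_mat_lower (t : T₂ K Λ) (a : Λ) :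
    t * mat K 0 0 a = mat K 0 0 ((lower K Λ).π t * a) := by
  obtain ⟨x, y, z, rfl⟩ := exists_eq_mat t
  simp

theorem mul_mat_corner (t : T₂ K Λ) (a : Λ) :
    t * mat K 0 a 0 = mat K 0 ((lower K Λ).π t * a) 0 := by
  obtain ⟨x, y, z, rfl⟩ := exists_eq_mat t
  simp

/-- Restriction along the projection to the lower right entry preserves complete resolutions. -/
def restrictionData : RestrictionData (lower K Λ).π where
  sec :=
    { toFun := fun a => mat K 0 0 a
      map_zero' := zero_eq_mat.symm
      map_add' := fun _ _ => by simp }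
  sec_mul t a := (mul_mat_lower t a).symm
  π_sec _ := rfl
  -- The annihilator of the kernel consists of the matrices with zero upper left entry: the bottom
  -- row, a copy of `Λ²` on which `T₂(Λ)` acts through the lower right entry.
  n := 2
  coord := ![corner K Λ, (lower K Λ).π]
  coord_mul k t s hs := by
    have h := congrArg (upper K Λ).π (hs (mat K 1 0 0) rfl)
    simp only [map_mul, upper_mat, one_mul, map_zero] at h
    fin_cases k
    · simp [corner_mul, h]
    · simp
  incl := ![
    { toFun := fun a => mat K 0 a 0
      map_zero' := zero_eq_mat.symm
      map_add' := fun _ _ => by simp },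
    { toFun := fun a => mat K 0 0 a
      map_zero' := zero_eq_mat.symm
      map_add' := fun _ _ => by simp }]
  incl_mul k t a := by
    fin_cases k
    · exact (mul_mat_corner t a).symm
    · exact (mul_mat_lower t a).symm
  sum_incl_coord s hs := by
    have h := congrArg (upper K Λ).π (hs (mat K 1 0 0) rfl)
    simp only [map_mul, upper_mat, one_mul, map_zero] at h
    conv_rhs => rw [← mat_entries s, h]
    simp

section Modules

variable {M : Type*} [AddCommGroup M] [Module (T₂ K Λ) M]

theorem smul_add_smul (x : M) : mat K (1 : Λ) 0 0 • x + mat K (0 : Λ) 0 1 • x = x := by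
  rw [← add_smul, mat_add]
  simp [← one_eq_mat]

theorem corner_smul_upper_smul (x : M) :
    mat K (0 : Λ) 1 0 • mat K (1 : Λ) 0 0 • x = mat K (0 : Λ) 1 0 • x := by
  simp [smul_smul]

theorem proj_upper_eq_zero {x : M} : (upper K Λ).proj x = 0 ↔ mat K (1 : Λ) 0 0 • x = 0 := by
  rw [SplitSurjection.proj_eq_zero]
  constructor
  · let L : Submodule (T₂ K Λ) M :=
      { carrier := {x | mat K (1 : Λ) 0 0 • x = 0}
        zero_mem' := smul_zero _
        add_mem' := fun {x y} hx hy => by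
          simp only [Set.mem_ofPred_eq] at hx hy ⊢
          rw [smul_add, hx, hy, add_zero]
        smul_mem' := fun t x hx => by
          simp only [Set.mem_ofPred_eq] at hx ⊢
          obtain ⟨a, b, c, rfl⟩ := exists_eq_mat t
          have : mat K 1 0 0 * mat K a b c = mat K a 0 0 * mat K 1 0 0 := by simp
          rw [smul_smul, this, mul_smul, hx, smul_zero] }
    have : (upper K Λ).kerSMul M ≤ L := Submodule.span_le.2 <| by
      rintro _ ⟨t, m, ht, rfl⟩
      obtain ⟨a, b, c, rfl⟩ := exists_eq_mat t
      obtain rfl : a = 0 := ht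
      change mat K 1 0 0 • mat K 0 b c • m = 0
      simp [smul_smul, ← zero_eq_mat]
    exact fun h => this h
  · intro h
    rw [← smul_add_smul (K := K) (Λ := Λ) x, h, zero_add]
    exact Submodule.subset_span ⟨_, x, rfl, rfl⟩

/-- The kernel of the lower projection is the first column, so the reduction discards the upper part
and its image under the corner. -/
theorem proj_lower_eq_zero {x : M} :
    (lower K Λ).proj x = 0 ↔ ∃ y : M, mat K (0 : Λ) 0 1 • x = mat K (0 : Λ) 1 0 • y := by
  constructor
  · rw [SplitSurjection.proj_eq_zero]
    let L : Submodule (T₂ K Λ) M :=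
      { carrier := {x | ∃ y : M, mat K (0 : Λ) 0 1 • x = mat K (0 : Λ) 1 0 • y}
        zero_mem' := ⟨0, by simp⟩
        add_mem' := by
          rintro x x' ⟨y, hy⟩ ⟨y', hy'⟩
          exact ⟨y + y', by rw [smul_add, smul_add, hy, hy']⟩
        smul_mem' := by
          rintro t x ⟨y, hy⟩
          obtain ⟨a, b, c, rfl⟩ := exists_eq_mat t
          refine ⟨mat K b 0 b • x + mat K c 0 c • y, ?_⟩
          have h₁ : mat K 0 0 1 * mat K a b c =
              mat K 0 1 0 * mat K b 0 b + mat K c 0 c * mat K 0 0 1 := by simp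
          have h₂ : mat K c 0 c * mat K 0 1 0 = mat K 0 1 0 * mat K c 0 c := by simp
          rw [smul_smul, h₁, add_smul, mul_smul _ _ x, mul_smul _ _ x, hy, smul_smul _ _ y, h₂,
            mul_smul, smul_add] }
    have : (lower K Λ).kerSMul M ≤ L := Submodule.span_le.2 <| by
      rintro _ ⟨t, m, ht, rfl⟩
      obtain ⟨a, b, c, rfl⟩ := exists_eq_mat t
      obtain rfl : c = 0 := ht
      exact ⟨mat K b 0 b • m, by simp [smul_smul]⟩
    exact fun h => this h
  · rintro ⟨y, hy⟩
    rw [← smul_add_smul (K := K) (Λ := Λ) x, hy, map_add,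
      SplitSurjection.proj_smul_eq_zero _ rfl, SplitSurjection.proj_smul_eq_zero _ rfl, add_zero]

/-- In a projective module the multiplication from the upper to the lower part is injective. -/
theorem upper_smul_eq_zero_of_corner_smul (hM : HasFiniteDualBasis (T₂ K Λ) M) {x : M}
    (hx : mat K (0 : Λ) 1 0 • x = 0) : mat K (1 : Λ) 0 0 • x = 0 := by
  obtain ⟨n, q, φ, hφ⟩ := hM
  rw [← hφ x, Finset.smul_sum]
  refine Finset.sum_eq_zero fun j _ => ?_
  have h := congrArg (φ j) hx
  rw [map_smul, map_zero] at h
  obtain ⟨a, b, c, habc⟩ := exists_eq_mat (φ j x)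
  rw [habc] at h ⊢
  have ha : a = 0 := by simpa using congrArg (corner K Λ) h
  simp [smul_smul, ha, ← zero_eq_mat]

end Modules

end T₂

/-! ### Complete resolutions over the triangular matrix algebra -/

namespace T₂

section Resolutions

variable {K : Type v} {Λ : Type u} [Field K] [Ring Λ] [Algebra K Λ]
  (C : CompleteResolution (T₂ K Λ))

/-- The corner part is an isomorphic copy of the upper part, by injectivity of the corner
multiplication on projectives, so it is exact as well. -/
theorem exists_corner_smul_eq {i j k : ℤ} (hij : i + 1 = j) (hjk : j + 1 = k) {y : C.X j}
    (hy : C.d j k hjk (mat K (0 : Λ) 1 0 • y) = 0) :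
    ∃ w, C.d i j hij (mat K (0 : Λ) 1 0 • w) = mat K (0 : Λ) 1 0 • y := by
  rw [map_smul] at hy
  have h := upper_smul_eq_zero_of_corner_smul (C.dualBasis k) hy
  rw [← map_smul] at h
  obtain ⟨w, hw⟩ := (C.exact i j k hij hjk _).1 h
  exact ⟨w, by rw [map_smul, hw, corner_smul_upper_smul]⟩

/-- The upper part of a complete resolution over `T₂(Λ)`. -/
def upperResolution : CompleteResolution Λ :=
  (upper K Λ).redResolution C
    (fun i j k hij hjk x hx => by
      rw [proj_upper_eq_zero, ← map_smul] at hx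
      obtain ⟨y, hy⟩ := (C.exact i j k hij hjk _).1 hx
      refine ⟨y, ?_⟩
      rw [hy, LinearMap.map_smulₛₗ, upper_mat, one_smul])
    (fun i j k hij hjk φ hφ => by
      let p : T₂ K Λ →ₛₗ[(upper K Λ).π] Λ :=
        { toFun := (upper K Λ).π
          map_add' := map_add _
          map_smul' := fun s t => map_mul _ s t }
      -- The aim is a map to `T₂(Λ)` with upper entry `φ` that vanishes on boundaries. A lift `ψ`
      -- may have a nonzero corner there. Moved to the lower entry, this corner gives `θ`, linear
      -- because the upper entry of `ψ d` is zero; it extends to `χ`, and `ω₀` subtracts the defect.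
      obtain ⟨ψ, hψ⟩ := (C.dualBasis j).exists_lift₂ φ φ p p fun x =>
        ⟨mat K (φ x) 0 0, rfl, rfl⟩
      have hψ : ∀ x, (upper K Λ).π (ψ x) = φ x := fun x => (hψ x).1
      let θ : C.X i →ₗ[T₂ K Λ] T₂ K Λ :=
        { toFun := fun y => mat K 0 0 (corner K Λ (ψ (C.d i j hij y)))
          map_add' := fun x y => by simp
          map_smul' := fun t x => by
            rw [map_smul, map_smul, smul_eq_mul, corner_mul, hψ, hφ, mul_zero, zero_add,
              RingHom.id_apply, smul_eq_mul, mul_mat_lower] }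
      obtain ⟨χ, hχ⟩ := C.dual_exact (i - 1) i j (by ring) hij θ <| LinearMap.ext fun y => by
        change mat K 0 0 (corner K Λ (ψ (C.d i j hij (C.d (i - 1) i _ y)))) = 0
        rw [C.d_d, map_zero, map_zero, zero_eq_mat]
      let ω₀ : C.X j →ₗ[T₂ K Λ] T₂ K Λ :=
        ψ.smulRight (mat K 1 0 0) - χ.smulRight (mat K 0 1 0)
      have hω₀ : ∀ x, ω₀ x = ψ x * mat K 1 0 0 - χ x * mat K 0 1 0 := fun x => rfl
      obtain ⟨ω, hω⟩ := C.dual_exact i j k hij hjk ω₀ <| LinearMap.ext fun y => by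
        have h₁ : χ (C.d i j hij y) = mat K 0 0 (corner K Λ (ψ (C.d i j hij y))) :=
          LinearMap.congr_fun hχ y
        have h₂ := mat_entries (ψ (C.d i j hij y))
        rw [hψ, hφ] at h₂
        rw [LinearMap.comp_apply, hω₀, h₁]
        conv_lhs => enter [1]; rw [← h₂]
        simp
      refine ⟨p.comp ω, fun x => ?_⟩
      have h := LinearMap.congr_fun hω x
      rw [LinearMap.comp_apply] at h
      change (upper K Λ).π (ω (C.d j k hjk x)) = φ x
      rw [h, hω₀, map_sub, map_mul, map_mul, hψ]
      simp)

/-- The lower quotient of a complete resolution over `T₂(Λ)`. -/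
def lowerResolution : CompleteResolution Λ :=
  (lower K Λ).redResolution C
    (fun i j k hij hjk x hx => by
      rw [proj_lower_eq_zero] at hx
      obtain ⟨y, hy⟩ := hx
      -- The boundary of the lower component of `x` is a corner cycle, hence the boundary of a
      -- corner element; subtracting that element leaves a genuine cycle.
      obtain ⟨z, hz⟩ := exists_corner_smul_eq C hjk rfl (y := y) <| by
        rw [← hy, map_smul, C.d_d, smul_zero]
      obtain ⟨v, hv⟩ := (C.exact i j k hij hjk
          (mat K (0 : Λ) 0 1 • x - mat K (0 : Λ) 1 0 • z)).1 <| by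
        rw [map_sub, map_smul, hy, hz, sub_self]
      refine ⟨v, ?_⟩
      rw [hv, map_sub, SplitSurjection.proj_smul_eq_zero _ rfl z, sub_zero, LinearMap.map_smulₛₗ,
        lower_mat, one_smul])
    (fun i j k hij hjk φ hφ => by
      obtain ⟨χ, hχ⟩ := C.dual_exact i j k hij hjk
        { toFun := fun x => mat K 0 0 (φ x)
          map_add' := fun x y => by simp
          map_smul' := fun t x => by
            rw [LinearMap.map_smulₛₗ, smul_eq_mul, RingHom.id_apply, smul_eq_mul,
              mul_mat_lower] } <| LinearMap.ext fun x => by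
          change mat K 0 0 (φ (C.d i j hij x)) = 0
          rw [hφ, zero_eq_mat]
      refine ⟨{ toFun := fun x => (lower K Λ).π (χ x)
                map_add' := fun x y => by simp
                map_smul' := fun t x => by simp }, fun x => ?_⟩
      exact congrArg (lower K Λ).π (LinearMap.congr_fun hχ x))

/-- Regularity of rigid differentials passes from `Λ` to `T₂(Λ)`. -/
theorem isRegularMap_of_entries
    (H : ∀ (C : CompleteResolution Λ) (i j : ℤ) (h : i + 1 = j),
      IsRigidMap (C.d i j h) → IsRegularMap (C.d i j h))
    (i j : ℤ) (h : i + 1 = j) (hC : IsRigidMap (C.d i j h)) : IsRegularMap (C.d i j h) := by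
  obtain ⟨s₁, hs₁⟩ := H (upperResolution C) i j h
    ((upper K Λ).isRigidMap_map (C.dualBasis i) hC)
  obtain ⟨s₂, hs₂⟩ := H (lowerResolution C) i j h
    ((lower K Λ).isRigidMap_map (C.dualBasis i) hC)
  change (upper K Λ).Red (C.X j) →ₗ[Λ] (upper K Λ).Red (C.X i) at s₁
  change (lower K Λ).Red (C.X j) →ₗ[Λ] (lower K Λ).Red (C.X i) at s₂
  set f := C.d i j h with hf
  obtain ⟨s, hs⟩ := (C.dualBasis j).exists_lift₂ (s₁.comp (upper K Λ).proj)
    (s₂.comp (lower K Λ).proj) (upper K Λ).proj (lower K Λ).proj fun x => by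
      obtain ⟨a, ha⟩ := (upper K Λ).proj_surjective (s₁ ((upper K Λ).proj x))
      obtain ⟨b, hb⟩ := (lower K Λ).proj_surjective (s₂ ((lower K Λ).proj x))
      refine ⟨mat K (1 : Λ) 0 0 • a + mat K (0 : Λ) 0 1 • b, ?_, ?_⟩
      · rw [map_add, SplitSurjection.proj_smul_eq_zero _ rfl b, add_zero, LinearMap.map_smulₛₗ,
          upper_mat, one_smul, ha, LinearMap.comp_apply]
      · rw [map_add, SplitSurjection.proj_smul_eq_zero _ rfl a, zero_add, LinearMap.map_smulₛₗ,
          lower_mat, one_smul, hb, LinearMap.comp_apply]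
  -- The defect of `s`. It vanishes on both reductions, so its values lie in the corner part; it
  -- kills the corner part because the corner squares to zero.
  let r : C.X i →ₗ[T₂ K Λ] C.X j := f - f.comp (s.comp f)
  have hr : ∀ x, r x = f x - f (s (f x)) := fun x => rfl
  have hr₁ : ∀ x, (upper K Λ).proj (r x) = 0 := fun x => by
    rw [hr, map_sub, sub_eq_zero, ← SplitSurjection.map_proj _ f (s (f x)), (hs _).1]
    exact (hs₁ ((upper K Λ).proj x)).symm
  have hr₂ : ∀ x, (lower K Λ).proj (r x) = 0 := fun x => by
    rw [hr, map_sub, sub_eq_zero, ← SplitSurjection.map_proj _ f (s (f x)), (hs _).2]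
    exact (hs₂ ((lower K Λ).proj x)).symm
  have hcorner : ∀ x, ∃ y, r x = mat K (0 : Λ) 1 0 • y := fun x => by
    obtain ⟨y, hy⟩ := proj_lower_eq_zero.1 (hr₂ x)
    exact ⟨y, by rw [← smul_add_smul (K := K) (Λ := Λ) (r x), proj_upper_eq_zero.1 (hr₁ x),
      zero_add, hy]⟩
  have hr_corner : ∀ w, r (mat K (0 : Λ) 1 0 • w) = 0 := fun w => by
    obtain ⟨y, hy⟩ := hcorner w
    rw [map_smul, hy, smul_smul, mat_mul]
    simp [← zero_eq_mat]
  have hr_ker : ∀ v, f v = 0 → r v = 0 := fun v hv => by simp [hr, hv]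
  -- Here `f (x - s (f x)) = r x` is a corner cycle, so it is `f` of a corner element. The
  -- difference lies in `ker f`, and `r` kills both pieces.
  have key : ∀ x, r (x - s (f x)) = 0 := fun x => by
    obtain ⟨y, hy⟩ := hcorner x
    obtain ⟨w, hw⟩ := exists_corner_smul_eq C h rfl (y := y) <| by
      rw [← hy, hr, map_sub, C.d_d, C.d_d, sub_zero]
    rw [← sub_add_cancel (x - s (f x)) (mat K (0 : Λ) 1 0 • w), map_add, hr_corner, add_zero]
    refine hr_ker _ ?_
    rw [map_sub, map_sub, ← hr, hy, hf, hw, sub_self]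
  -- Expanding `r (1 - s f) = 0` gives `f = f (2s - s f s) f`.
  refine ⟨s + s - s.comp (f.comp s), fun x => ?_⟩
  have := key x
  rw [hr, map_sub, map_sub] at this
  simp only [LinearMap.sub_apply, LinearMap.add_apply, LinearMap.comp_apply, map_sub,
    map_add] at this ⊢
  rw [← sub_eq_zero, ← neg_eq_zero, ← this]
  abel

end Resolutions

/-- CM-`τ`-tilting freeness passes between `Λ` and `T₂(Λ)`, without any Gorenstein hypothesis. -/
theorem isCMTauTiltingFree_iff (K : Type v) [Field K] (Λ : Type u) [Ring Λ] [Algebra K Λ]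
    [FiniteDimensional K Λ] : IsCMTauTiltingFree K Λ ↔ IsCMTauTiltingFree K (T₂ K Λ) := by
  rw [_root_.isCMTauTiltingFree_iff, _root_.isCMTauTiltingFree_iff]
  exact ⟨fun H C => isRegularMap_of_entries C H, restrictionData.isRegularMap⟩

end T₂

end

theorem theorem1p1 (K : Type v) [Field K] [IsAlgClosed K]
    (Λ : Type u) [Ring Λ] [Algebra K Λ] [FiniteDimensional K Λ] :
    (IsCMTauTiltingFree K Λ ↔ IsCMTauTiltingFree K Λᵐᵒᵖ) ∧
    (IsGorensteinAlgebra Λ → (IsCMTauTiltingFree K Λ ↔ IsCMTauTiltingFree K (T₂ K Λ))) :=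
  ⟨isCMTauTiltingFree_opposite_iff K Λ, fun _ => T₂.isCMTauTiltingFree_iff K Λ⟩
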